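/- Assume $\mathfrak{d}\le\mathfrak{r}$. Then for each nonprincipal ultrafilter $U$ on $\mathbb{N}$ there is a set of reals that is Scheepers but not $U$-Menger. Here $[\mathbb{N}]^{\infty}$ is the family of infinite subsets of $\mathbb{N}$, and each $a\in[\mathbb{N}]^{\infty}$ is identified with its increasing enumeration, $a(n)$ being the $n$-th smallest element of $a$. The dominating number $\mathfrak{d}$ is the minimal cardinality of a set $D\subseteq[\mathbb{N}]^{\infty}$ such that for each $x\in[\mathbb{N}]^{\infty}$ there is $y\in D$ with $\{n: y(n)<x(n)\}$ finite. The reaping number $\mathfrak{r}$ is the minimal cardinality of a family $A\subseteq[\mathbb{N}]^{\infty}$ for which there is no $r\in[\mathbb{N}]^{\infty}$ such that $a\cap r$ and $a\setminus r$ are infinite for all $a\in A$. A set of reals is a subset of $\mathbb{R}$ with the subspace topology. A topological space $X$ is Scheepers if for each sequence $(\mathcal{C}_n)_{n}$ of open covers of $X$ there are finite sets $\mathcal{F}_n\subseteq\mathcal{C}_n$ such that each finite subset of $X$ is contained in $\bigcup\mathcal{F}_n$ for some $n$. The space $X$ is $U$-Menger if for each such sequence $(\mathcal{C}_n)_{n}$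 there are finite sets $\mathcal{F}_n\subseteq\mathcal{C}_n$ such that $\{n: x\in\bigcup\mathcal{F}_n\}\in U$ for each $x\in X$. -/

import Mathlib

/-- The set `[ℕ]^∞` of infinite subsets of `ℕ`. -/
abbrev InfNatSet : Type := {a : Set ℕ // a.Infinite}

/-- The increasing enumeration of an infinite set `a`: `a.enum n` is the `n`-th smallest
element of `a`, counting from `0`. -/
noncomputable def InfNatSet.enum (a : InfNatSet) (n : ℕ) : ℕ := Nat.nth (fun k => k ∈ a.1) n

/-- `x ≤* y`: the set of all `n` with `y(n) < x(n)` is finite. -/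
def InfNatSet.DominatedBy (x y : InfNatSet) : Prop := {n : ℕ | y.enum n < x.enum n}.Finite

/-- Every element of `[ℕ]^∞` is dominated by some member of `D`. -/
def IsDominatingFamily (D : Set InfNatSet) : Prop := ∀ x : InfNatSet, ∃ d ∈ D, x.DominatedBy d

/-- The dominating number `𝔡`. -/
noncomputable def dominatingNumber : Cardinal.{0} :=
  sInf {κ : Cardinal.{0} | ∃ D : Set InfNatSet, IsDominatingFamily D ∧ Cardinal.mk D = κ}

/-- The set `r` reaps the family `A`: for all `a ∈ A`, both `a ∩ r` and `a \ r` are infinite. -/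
def Reaps (r : InfNatSet) (A : Set InfNatSet) : Prop :=
  ∀ a ∈ A, (a.1 ∩ r.1).Infinite ∧ (a.1 \ r.1).Infinite

/-- The reaping number `𝔯`. -/
noncomputable def reapingNumber : Cardinal.{0} :=
  sInf {κ : Cardinal.{0} | ∃ A : Set InfNatSet, (¬ ∃ r : InfNatSet, Reaps r A) ∧ Cardinal.mk A = κ}

/-- A family of open sets that covers the space. -/
def IsOpenCoverFamily (X : Type*) [TopologicalSpace X] (𝒞 : Set (Set X)) : Prop :=
  (∀ V ∈ 𝒞, IsOpen V) ∧ ⋃₀ 𝒞 = Set.univ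

/-- The Scheepers property: from every sequence of open covers one can choose finite
subfamilies such that each finite subset of the space is contained in the union of one of
the chosen subfamilies. -/
def IsScheepers (X : Type*) [TopologicalSpace X] : Prop :=
  ∀ 𝒞 : ℕ → Set (Set X), (∀ n, IsOpenCoverFamily X (𝒞 n)) →
    ∃ ℱ : ℕ → Set (Set X), (∀ n, ℱ n ⊆ 𝒞 n ∧ (ℱ n).Finite) ∧
      ∀ S : Set X, S.Finite → ∃ n, S ⊆ ⋃₀ ℱ n

/-- The `U`-Menger property: from every sequence of open covers one can choose finite
subfamilies such that, for each point `x`, the set of all `n` for which `x` belongs to the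
union of the `n`-th chosen subfamily is a member of `U`. -/
def IsUMenger (U : Ultrafilter ℕ) (X : Type*) [TopologicalSpace X] : Prop :=
  ∀ 𝒞 : ℕ → Set (Set X), (∀ n, IsOpenCoverFamily X (𝒞 n)) →
    ∃ ℱ : ℕ → Set (Set X), (∀ n, ℱ n ⊆ 𝒞 n ∧ (ℱ n).Finite) ∧
      ∀ x : X, {n : ℕ | x ∈ ⋃₀ ℱ n} ∈ U

open Filter Cardinal Topology

/-! Subsets of ℕ are points of the Cantor space, which embeds in ℝ. A space of infinite sets fails
to be `U`-Menger if for every `b` some point misses `[n, b n)` for `U`-many `n`.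

If some family of fewer than 𝔡 functions is unbounded modulo `U`, thin infinite sets missing the
corresponding intervals on a set in `U` form such a space; having fewer than 𝔡 points, it is
Scheepers.

Otherwise, well-order a dominating family `d i` in type 𝔡 and build `x i` recursively
(`exists_gapSet_family`) so that the complement of `x i` misses `[n, d i n)` for `U`-many `n`, while
finitely many sets `gapSet (x i) (d j)`, `j ≤ i`, always meet in an infinite set. Here 𝔡 ≤ 𝔯 is
used: one set must split fewer than 𝔡 sets (`exists_gapSet_mem_and_infinite`). The space consists of
all `x i` and all finite sets. The complements refute `U`-Menger. For Scheepers
(`isScheepers_of_gapSet_family`), a bound computed at the finite sets also serves every point with a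
long enough gap after `n`; the late `x i` have such gaps, and the early ones are bounded through a
single later `x δ`. -/

/-- The set of all `n` such that `x` misses the interval `[n, f n)`. -/
def gapSet (x : Set ℕ) (f : ℕ → ℕ) : Set ℕ := {n | ∀ m, n ≤ m → m < f n → m ∉ x}

theorem gapSet_anti {x : Set ℕ} {f g : ℕ → ℕ} {n : ℕ} (h : f n ≤ g n) (hn : n ∈ gapSet x g) :
    n ∈ gapSet x f := fun m h1 h2 => hn m h1 (h2.trans_le h)

theorem exists_strictMono_ge (f : ℕ → ℕ) : ∃ k : ℕ → ℕ, StrictMono k ∧ ∀ n, f n ≤ k n := by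
  refine ⟨fun n => ∑ i ∈ Finset.range (n + 1), (f i + 1), strictMono_nat_of_lt_succ fun n => ?_,
    fun n => ?_⟩
  · rw [Finset.sum_range_succ _ (n + 1)]
    omega
  · exact (Nat.le_succ _).trans (Finset.single_le_sum (f := fun i => f i + 1)
      (fun _ _ => Nat.zero_le _) (Finset.self_mem_range_succ n))

/-! ### Cardinal invariants -/

theorem InfNatSet.exists_enum_eq {k : ℕ → ℕ} (hk : StrictMono k) : ∃ a : InfNatSet, a.enum = k := by
  have hinf : (Set.range k).Infinite := Set.infinite_range_of_injective hk.injective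
  refine ⟨⟨Set.range k, hinf⟩, ?_⟩
  have hs : StrictMono (InfNatSet.enum ⟨Set.range k, hinf⟩) := Nat.nth_strictMono hinf
  rw [← StrictMono.range_inj hs hk]
  exact Nat.range_nth_of_infinite hinf

theorem InfNatSet.exists_le_enum (f : ℕ → ℕ) : ∃ a : InfNatSet, ∀ n, f n ≤ a.enum n := by
  obtain ⟨k, hk, hf⟩ := exists_strictMono_ge f
  obtain ⟨a, rfl⟩ := InfNatSet.exists_enum_eq hk
  exact ⟨a, hf⟩

theorem InfNatSet.enum_strictMono (a : InfNatSet) : StrictMono a.enum := Nat.nth_strictMono a.2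

theorem exists_isDominatingFamily :
    ∃ D : Set InfNatSet, IsDominatingFamily D ∧ #D = dominatingNumber := by
  refine csInf_mem (s := {κ : Cardinal.{0} | ∃ D : Set InfNatSet, IsDominatingFamily D ∧ #D = κ})
    ⟨_, Set.univ, fun x => ⟨x, trivial, ?_⟩, rfl⟩
  simp [InfNatSet.DominatedBy]

theorem exists_strictMono_infinite_le {ι : Type} (y : ι → ℕ → ℕ) (hι : #ι < dominatingNumber) :
    ∃ h : ℕ → ℕ, StrictMono h ∧ ∀ i, {n | y i n ≤ h n}.Infinite := by
  choose a ha using fun i => InfNatSet.exists_le_enum (y i)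
  have hD : ¬ IsDominatingFamily (Set.range a) := fun hD =>
    notMem_of_lt_csInf' (mk_range_le.trans_lt hι) ⟨_, hD, rfl⟩
  simp only [IsDominatingFamily, Set.exists_range_iff, not_forall, not_exists] at hD
  obtain ⟨x, hx⟩ := hD
  exact ⟨x.enum, x.enum_strictMono, fun i =>
    Set.Infinite.mono (fun n hn => (ha i n).trans (le_of_lt hn)) (hx i)⟩

theorem aleph0_lt_dominatingNumber : ℵ₀ < dominatingNumber := by
  by_contra! hle
  obtain ⟨D, hD, hc⟩ := exists_isDominatingFamily
  rw [← hc, mk_le_aleph0_iff] at hle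
  obtain ⟨d₀, hd₀, -⟩ := hD ⟨Set.univ, Set.infinite_univ⟩
  have : Nonempty D := ⟨⟨d₀, hd₀⟩⟩
  obtain ⟨s, hs⟩ := exists_surjective_nat D
  obtain ⟨a, ha⟩ := InfNatSet.exists_le_enum
    fun n => (Finset.range (n + 1)).sup (fun i => (s i).1.enum n) + 1
  obtain ⟨d, hd, hfin⟩ := hD a
  obtain ⟨j, hj⟩ := hs ⟨d, hd⟩
  refine (Set.Ici_infinite j).mono (fun n hn => ?_) hfin
  have h1 : (s j).1.enum n ≤ _ := Finset.le_sup (f := fun i => (s i).1.enum n)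
    (Finset.mem_range.2 (Nat.lt_succ_of_le hn))
  have h2 := ha n
  rw [hj] at h1
  exact (Nat.lt_succ_of_le h1).trans_le h2

theorem mk_finset_lt_dominatingNumber {ι : Type} (hι : #ι < dominatingNumber) :
    #(Finset ι) < dominatingNumber := by
  rcases finite_or_infinite ι with h | h
  · exact (mk_lt_aleph0).trans aleph0_lt_dominatingNumber
  · rwa [mk_finset_of_infinite]

theorem exists_reaps_of_lt {ι : Type} (a : ι → InfNatSet) (hι : #ι < reapingNumber) :
    ∃ r : InfNatSet, Reaps r (Set.range a) := by
  by_contra h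
  exact notMem_of_lt_csInf' (mk_range_le.trans_lt hι) ⟨_, h, rfl⟩

/-- Evaluate `f i` at an element of `a i` beyond `n`: since `h` is monotone, a bound by `h n`
persists at that element. -/
theorem exists_strictMono_infinite_inter {ι : Type} (a : ι → Set ℕ) (f : ι → ℕ → ℕ)
    (hι : #ι < dominatingNumber) (ha : ∀ i, (a i).Infinite) :
    ∃ h : ℕ → ℕ, StrictMono h ∧ ∀ i, {n ∈ a i | f i n ≤ h n}.Infinite := by
  choose s hs hsa using fun i n => (ha i).exists_gt n
  obtain ⟨h, hh, hi⟩ := exists_strictMono_infinite_le (fun i n => f i (s i n)) hι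
  refine ⟨h, hh, fun i => Set.infinite_of_not_bddAbove ?_⟩
  rintro ⟨N, hN⟩
  obtain ⟨n, hn, hNn⟩ := (hi i).exists_gt N
  have hle : n ≤ s i n := (hsa i n).le
  have := hN ⟨hs i n, hn.trans (hh.monotone hle)⟩
  omega

/-! ### Interval partitions -/

theorem exists_blockIndex (h : ℕ → ℕ) : ∃ idx : ℕ → ℕ, (∀ i, {n | idx n ≤ i}.Finite) ∧
    ∀ n m, n ≤ m → m < h n → idx n ≤ idx m ∧ idx m ≤ idx n + 1 := by
  obtain ⟨H, hH, hle⟩ := exists_strictMono_ge h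
  obtain ⟨k, hk, hkH⟩ : ∃ k : ℕ → ℕ, StrictMono k ∧ ∀ i, H (k i) ≤ k (i + 1) :=
    ⟨fun i => Nat.rec 0 (fun _ a => max (a + 1) (H a)) i,
      strictMono_nat_of_lt_succ fun _ => lt_max_of_lt_left (Nat.lt_succ_self _),
      fun _ => le_max_right _ _⟩
  have hex : ∀ n, ∃ i, n < k i := fun n => ⟨n + 1, (Nat.lt_succ_self n).trans_le (hk.le_apply)⟩
  have hlt : ∀ n, n < k (Nat.find (hex n)) := fun n => Nat.find_spec (hex n)
  refine ⟨fun n => Nat.find (hex n), fun i => (Set.finite_Iio (k i)).subset fun n hn => ?_,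
    fun n m hnm hm => ⟨?_, ?_⟩⟩
  · exact (hlt n).trans_le (hk.monotone hn)
  · exact Nat.find_min' (hex n) (hnm.trans_lt (hlt m))
  · refine Nat.find_min' (hex m) ?_
    exact ((hm.trans_le (hle n)).trans_le (hH.monotone (hlt n).le)).trans_le (hkH _)

/-- For a small directed family of infinite sets, intervals can be coarsely grouped so that
both the ultrafilter and the family concentrate on points whose `h`-interval stays in a group. -/
theorem exists_grouping {ι : Type} (A : ι → Set ℕ) (hA : ∀ c, (A c).Infinite)
    (hdir : ∀ c d, ∃ e, A e ⊆ A c ∩ A d) (U : Ultrafilter ℕ) (h : ℕ → ℕ) :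
    ∃ (g : ℕ → ℕ) (B : Set ℕ), (∀ j, (g ⁻¹' {j}).Finite) ∧ B ∉ U ∧ (∀ c, (A c \ B).Infinite) ∧
      ∀ n ∉ B, ∀ m, n ≤ m → m < h n → g m = g n := by
  obtain ⟨idx, hfin, hidx⟩ := exists_blockIndex h
  -- Three consecutive blocks form a group and `s` shifts the grouping; the bad points lie in the
  -- last block of a group, whence an `h`-interval may spill over. The three bad sets are disjoint,
  -- so at most one is in `U` and, by directedness, at most one almost contains some `A c`. A shift
  -- is left over.
  suffices hs : ∃ s, {n | (idx n + s) % 3 = 2} ∉ U ∧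
      ∀ c, (A c \ {n | (idx n + s) % 3 = 2}).Infinite by
    obtain ⟨s, hU, hc⟩ := hs
    refine ⟨fun n => (idx n + s) / 3, _, fun j => (hfin (3 * j + 2)).subset fun n hn => ?_, hU, hc,
      fun n hn m hnm hm => ?_⟩
    · simp only [Set.mem_preimage, Set.mem_singleton_iff, Set.mem_ofPred_eq] at hn ⊢
      omega
    · have := hidx n m hnm hm
      simp only [Set.mem_ofPred_eq] at hn ⊢
      omega
  have hU : ∀ s t, s < t → t < 3 → {n | (idx n + s) % 3 = 2} ∈ U →
      {n | (idx n + t) % 3 = 2} ∈ U → False := fun s t hst ht h1 h2 => by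
    obtain ⟨n, hn1, hn2⟩ := U.nonempty_of_mem (inter_mem h1 h2)
    simp only [Set.mem_ofPred_eq] at hn1 hn2
    omega
  have hb : ∀ s t, s < t → t < 3 → (∃ c, (A c \ {n | (idx n + s) % 3 = 2}).Finite) →
      (∃ c, (A c \ {n | (idx n + t) % 3 = 2}).Finite) → False := by
    rintro s t hst ht ⟨c, hc⟩ ⟨d, hd⟩
    obtain ⟨e, he⟩ := hdir c d
    refine hA e ((hc.union hd).subset fun n hn => ?_)
    have := he hn
    by_cases hs : (idx n + s) % 3 = 2
    · exact Or.inr ⟨this.2, fun (hn2 : (idx n + t) % 3 = 2) => by omega⟩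
    · exact Or.inl ⟨this.1, hs⟩
  by_contra! hcon
  by_cases m0 : {n | (idx n + 0) % 3 = 2} ∈ U
  · exact hb 1 2 (by omega) (by omega) (hcon 1 (hU 0 1 (by omega) (by omega) m0))
      (hcon 2 (hU 0 2 (by omega) (by omega) m0))
  · by_cases m1 : {n | (idx n + 1) % 3 = 2} ∈ U
    · exact hb 0 2 (by omega) (by omega) (hcon 0 m0) (hcon 2 (hU 1 2 (by omega) (by omega) m1))
    · exact hb 0 1 (by omega) (by omega) (hcon 0 m0) (hcon 1 m1)

/-- The set `x` is a union of groups, selected by a set `R` of labels that splits every `g '' (A c \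
B)`, or by its complement, whichever makes `x` belong to `U`. Off `B` an `h`-interval stays in one
group, so it lies inside `x` or misses it. -/
theorem exists_gapSet_mem_and_infinite {ι : Type} [Nonempty ι] (A : ι → Set ℕ)
    (hι : #ι < reapingNumber) (hA : ∀ c, (A c).Infinite) (hdir : ∀ c d, ∃ e, A e ⊆ A c ∩ A d)
    (U : Ultrafilter ℕ) (hU : ∀ u ∈ U, u.Infinite) (h : ℕ → ℕ) :
    ∃ x : Set ℕ, x.Infinite ∧ xᶜ.Infinite ∧ gapSet xᶜ h ∈ U ∧
      ∀ c, (A c ∩ gapSet x h).Infinite := by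
  obtain ⟨g, B, hg, hBU, hAB, hgB⟩ := exists_grouping A hA hdir U h
  have himg : ∀ c, (g '' (A c \ B)).Infinite := fun c hfin =>
    hAB c ((hfin.preimage' fun b _ => hg b).subset (Set.subset_preimage_image g _))
  obtain ⟨r, hr⟩ := exists_reaps_of_lt (fun c => ⟨g '' (A c \ B), himg c⟩) hι
  obtain ⟨R, hRU, hR⟩ : ∃ R : Set ℕ, g ⁻¹' R ∈ U ∧ ∀ c, (g '' (A c \ B) \ R).Infinite := by
    rcases U.mem_or_compl_mem (g ⁻¹' r.1) with hm | hm
    · exact ⟨r.1, hm, fun c => (hr _ ⟨c, rfl⟩).2⟩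
    · refine ⟨r.1ᶜ, hm, fun c => ?_⟩
      rw [Set.sdiff_eq, compl_compl]
      exact (hr _ ⟨c, rfl⟩).1
  have hinf : ∀ c, {n ∈ A c \ B | g n ∉ R}.Infinite := fun c hfin => by
    refine hR c ((hfin.image g).subset ?_)
    rintro _ ⟨⟨n, hn, rfl⟩, hnR⟩
    exact ⟨n, ⟨hn, hnR⟩, rfl⟩
  refine ⟨g ⁻¹' R, hU _ hRU, ?_, ?_, fun c => (hinf c).mono ?_⟩
  · exact (hinf (Classical.arbitrary ι)).mono fun n hn => hn.2
  · filter_upwards [hRU, Ultrafilter.compl_mem_iff_notMem.2 hBU] with n hn hnB m hnm hm hmR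
    exact hmR (by rw [Set.mem_preimage, hgB n hnB m hnm hm]; exact hn)
  · rintro n ⟨⟨hn, hnB⟩, hnR⟩
    refine ⟨hn, fun m hnm hm hmR => hnR ?_⟩
    rw [← hgB n hnB m hnm hm]
    exact hmR

theorem exists_gapSet_extension (hdr : dominatingNumber ≤ reapingNumber)
    {U : Ultrafilter ℕ} (hU : ∀ u ∈ U, u.Infinite) {ι J : Type} (a : ι → Set ℕ) (f : J → ℕ → ℕ)
    (hι : #ι < dominatingNumber) (hJ : #J < dominatingNumber)
    (ha : ∀ t : Finset ι, (⋂ i ∈ t, a i).Infinite) (f₀ : ℕ → ℕ) :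
    ∃ x : Set ℕ, x.Infinite ∧ xᶜ.Infinite ∧ gapSet xᶜ f₀ ∈ U ∧
      ∀ (t : Finset ι) (s : Finset J), ((⋂ i ∈ t, a i) ∩ ⋂ j ∈ s, gapSet x (f j)).Infinite := by
  classical
  have hC : #(Finset ι × Finset J) < dominatingNumber := by
    rw [← mul_def]
    exact mul_lt_of_lt aleph0_lt_dominatingNumber.le (mk_finset_lt_dominatingNumber hι)
      (mk_finset_lt_dominatingNumber hJ)
  obtain ⟨h, -, hh⟩ := exists_strictMono_infinite_inter
    (fun c : Finset ι × Finset J => ⋂ i ∈ c.1, a i) (fun c n => c.2.sup fun j => f j n) hC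
    fun c => ha c.1
  let h' : ℕ → ℕ := fun n => max (h n) (f₀ n)
  obtain ⟨x, hx, hxc, hxU, hxA⟩ := exists_gapSet_mem_and_infinite
    (fun c : Finset ι × Finset J => {n ∈ ⋂ i ∈ c.1, a i | (c.2.sup fun j => f j n) ≤ h n})
    (hC.trans_le hdr) hh (fun c d => ⟨(c.1 ∪ d.1, c.2 ∪ d.2), fun n hn => by
      simp only [Set.mem_ofPred_eq, Set.mem_iInter, Finset.mem_union, Finset.sup_le_iff,
        Set.mem_inter_iff] at hn ⊢
      exact ⟨⟨fun i hi => hn.1 i (.inl hi), fun j hj => hn.2 j (.inl hj)⟩,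
        fun i hi => hn.1 i (.inr hi), fun j hj => hn.2 j (.inr hj)⟩⟩) U hU h'
  refine ⟨x, hx, hxc, mem_of_superset hxU fun n hn => gapSet_anti (le_max_right _ _) hn,
    fun t s => (hxA (t, s)).mono ?_⟩
  rintro n ⟨⟨hn1, hn2⟩, hn⟩
  refine ⟨hn1, Set.mem_iInter₂.2 fun j hj => gapSet_anti ?_ hn⟩
  exact ((Finset.sup_le_iff.1 hn2) j hj).trans (le_max_left _ _)

/-! ### The recursive construction -/

theorem exists_forall_of_wellFoundedLT {I Z : Type*} [LT I] [WellFoundedLT I] [Nonempty Z]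
    (R : I → (I → Z) → Z → Prop) (hR : ∀ i f, ∃ v, R i f v) :
    ∃ z : I → Z, ∀ i, ∃ f : I → Z, (∀ j < i, f j = z j) ∧ R i f (z i) := by
  classical
  choose F hF using hR
  let ext : ∀ i, (∀ j, j < i → Z) → I → Z := fun i rec j =>
    if h : j < i then rec j h else Classical.arbitrary Z
  let z : I → Z := IsWellFounded.fix (· < ·) fun i rec => F i (ext i rec)
  refine ⟨z, fun i => ⟨ext i fun j _ => z j, fun j hj => dif_pos hj, ?_⟩⟩
  have : z i = F i (ext i fun j _ => z j) := IsWellFounded.fix_eq _ _ i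
  rw [this]
  exact hF _ _

theorem exists_gapSet_family (hdr : dominatingNumber ≤ reapingNumber)
    {U : Ultrafilter ℕ} (hU : ∀ u ∈ U, u.Infinite) {I : Type} [LinearOrder I] [WellFoundedLT I]
    (hI : ∀ i : I, #(Set.Iic i) < dominatingNumber) (d : I → ℕ → ℕ) :
    ∃ x : I → Set ℕ, (∀ i, (x i).Infinite ∧ (x i)ᶜ.Infinite ∧ gapSet (x i)ᶜ (d i) ∈ U) ∧
      ∀ T : Finset (I × I), (∀ p ∈ T, p.2 ≤ p.1) →
        (⋂ p ∈ T, gapSet (x p.1) (d p.2)).Infinite := by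
  classical
  obtain ⟨x, hx⟩ := exists_forall_of_wellFoundedLT
    -- The requirement is an implication, so that a value exists for every `f`; its premise is
    -- verified for the actual `x` by induction in `hle`.
    (fun (i : I) (f : I → Set ℕ) (v : Set ℕ) =>
      (∀ T : Finset (I × I), (∀ p ∈ T, p.1 < i ∧ p.2 ≤ p.1) →
        (⋂ p ∈ T, gapSet (f p.1) (d p.2)).Infinite) →
      (v.Infinite ∧ vᶜ.Infinite ∧ gapSet vᶜ (d i) ∈ U) ∧
      ∀ (T : Finset (I × I)) (s : Finset I), (∀ p ∈ T, p.1 < i ∧ p.2 ≤ p.1) → (∀ j ∈ s, j ≤ i) →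
        ((⋂ p ∈ T, gapSet (f p.1) (d p.2)) ∩ ⋂ j ∈ s, gapSet v (d j)).Infinite) (by
    intro i f
    by_cases hf : ∀ T : Finset (I × I), (∀ p ∈ T, p.1 < i ∧ p.2 ≤ p.1) →
        (⋂ p ∈ T, gapSet (f p.1) (d p.2)).Infinite
    swap
    · exact ⟨∅, fun h => absurd h hf⟩
    have hcard : #{p : I × I // p.1 < i ∧ p.2 ≤ p.1} < dominatingNumber := by
      refine (mk_le_of_injective (β := Set.Iic i × Set.Iic i)
        (f := fun p => (⟨p.1.1, p.2.1.le⟩, ⟨p.1.2, p.2.2.trans p.2.1.le⟩)) ?_).trans_lt ?_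
      · rintro ⟨⟨a, b⟩, _⟩ ⟨⟨c, e⟩, _⟩ h
        simpa [Subtype.ext_iff] using h
      · rw [← mul_def]
        exact mul_lt_of_lt aleph0_lt_dominatingNumber.le (hI i) (hI i)
    obtain ⟨v, h1, h2, h3, h4⟩ := exists_gapSet_extension hdr hU
      (fun p : {p : I × I // p.1 < i ∧ p.2 ≤ p.1} => gapSet (f p.1.1) (d p.1.2))
      (fun j : Set.Iic i => d j) hcard (hI i) (fun t => by
        refine (hf (t.map (Function.Embedding.subtype _)) fun p hp => ?_).mono fun n hn => ?_
        · obtain ⟨q, -, rfl⟩ := Finset.mem_map.1 hp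
          exact q.2
        · simp only [Set.mem_iInter] at hn ⊢
          exact fun q hq => hn q.1 (Finset.mem_map_of_mem _ hq)) (d i)
    refine ⟨v, fun _ => ⟨⟨h1, h2, h3⟩, fun T s hT hs => ?_⟩⟩
    refine (h4 (T.subtype _) (s.subtype _)).mono fun n hn => ?_
    simp only [Set.mem_inter_iff, Set.mem_iInter, Finset.mem_subtype] at hn ⊢
    exact ⟨fun p hp => hn.1 ⟨p, hT p hp⟩ hp, fun j hj => hn.2 ⟨j, hs j hj⟩ hj⟩)
  have hmax : ∀ T : Finset (I × I), T.Nonempty → ∃ p ∈ T, ∀ q ∈ T, q.1 ≤ p.1 := fun T hT =>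
    T.exists_max_image Prod.fst hT
  have huniv : (⋂ p ∈ (∅ : Finset (I × I)), gapSet (x p.1) (d p.2)).Infinite := by
    simpa using Set.infinite_univ
  have hlt : ∀ i, (∀ j < i, ∀ T : Finset (I × I), (∀ p ∈ T, p.1 ≤ j ∧ p.2 ≤ p.1) →
      (⋂ p ∈ T, gapSet (x p.1) (d p.2)).Infinite) → ∃ f : I → Set ℕ, (∀ j < i, f j = x j) ∧
      (((x i).Infinite ∧ (x i)ᶜ.Infinite ∧ gapSet (x i)ᶜ (d i) ∈ U) ∧
      ∀ (T : Finset (I × I)) (s : Finset I), (∀ p ∈ T, p.1 < i ∧ p.2 ≤ p.1) → (∀ j ∈ s, j ≤ i) →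
        ((⋂ p ∈ T, gapSet (f p.1) (d p.2)) ∩ ⋂ j ∈ s, gapSet (x i) (d j)).Infinite) := by
    intro i hi
    obtain ⟨f, hf, hfi⟩ := hx i
    refine ⟨f, hf, hfi fun T hT => ?_⟩
    have hTx : (⋂ p ∈ T, gapSet (x p.1) (d p.2)).Infinite := by
      rcases T.eq_empty_or_nonempty with rfl | hne
      · exact huniv
      · obtain ⟨p, hp, hpm⟩ := hmax T hne
        exact hi p.1 (hT p hp).1 T fun q hq => ⟨hpm q hq, (hT q hq).2⟩
    refine hTx.mono fun n hn => ?_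
    simp only [Set.mem_iInter] at hn ⊢
    exact fun p hp => by rw [hf _ (hT p hp).1]; exact hn p hp
  have hle : ∀ i, ∀ T : Finset (I × I), (∀ p ∈ T, p.1 ≤ i ∧ p.2 ≤ p.1) →
      (⋂ p ∈ T, gapSet (x p.1) (d p.2)).Infinite := by
    intro i
    induction i using WellFoundedLT.induction with
    | ind i ih =>
      intro T hT
      obtain ⟨f, hf, -, h2⟩ := hlt i ih
      refine (h2 (T.filter fun p => p.1 < i) ((T.filter fun p => p.1 = i).image Prod.snd)
        (fun p hp => ?_) (fun j hj => ?_)).mono fun n hn => ?_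
      · rw [Finset.mem_filter] at hp
        exact ⟨hp.2, (hT p hp.1).2⟩
      · obtain ⟨p, hp, rfl⟩ := Finset.mem_image.1 hj
        rw [Finset.mem_filter] at hp
        exact (hT p hp.1).2.trans hp.2.le
      · simp only [Set.mem_inter_iff, Set.mem_iInter, Finset.mem_filter, Finset.mem_image] at hn ⊢
        intro p hp
        rcases (hT p hp).1.lt_or_eq with h | h
        · rw [← hf _ h]
          exact hn.1 p ⟨hp, h⟩
        · rw [h]
          exact hn.2 p.2 ⟨p, ⟨hp, h⟩, rfl⟩
  refine ⟨x, fun i => ?_, fun T hT => ?_⟩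
  · obtain ⟨f, -, h, -⟩ := hlt i fun j _ => hle j
    exact h
  · rcases T.eq_empty_or_nonempty with rfl | hne
    · exact huniv
    · obtain ⟨p, -, hpm⟩ := hmax T hne
      exact hle p.1 T fun q hq => ⟨hpm q hq, hT q hq⟩

/-! ### Covering properties of subspaces of the Cantor space -/

theorem exists_forall_lt_imp_mem {X : Type*} [TopologicalSpace X] {e : X → ℕ → Bool}
    (he : IsInducing e) {C : Set X} (hC : IsOpen C) {p : X} (hp : p ∈ C) :
    ∃ k : ℕ, ∀ q, (∀ m < k, e p m = e q m) → q ∈ C := by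
  obtain ⟨V, hV, rfl⟩ := he.isOpen_iff.1 hC
  obtain ⟨s, u, hu, hsub⟩ := isOpen_pi_iff.1 hV (e p) hp
  refine ⟨s.sup id + 1, fun q hq => hsub fun m hm => ?_⟩
  rw [← hq m (Nat.lt_succ_of_le (Finset.le_sup (f := id) hm))]
  exact (hu m hm).2

/-- The function `y p n` stands for the least length of an initial segment of `e p` that forces
membership in a single element of `𝒞 n`. Only finitely many binary strings have length `b n`, so a
bound `b` yields finite subfamilies. -/
theorem isScheepers_of_isInducing {X : Type*} [TopologicalSpace X] {e : X → ℕ → Bool}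
    (he : IsInducing e)
    (H : ∀ y : X → ℕ → ℕ, (∀ p q n, (∀ m < y p n, e p m = e q m) → y q n ≤ y p n) →
      ∃ b : ℕ → ℕ, ∀ S : Set X, S.Finite → ∃ n, ∀ p ∈ S, y p n ≤ b n) : IsScheepers X := by
  classical
  intro 𝒞 h𝒞
  have hex : ∀ p n, ∃ k : ℕ, ∃ C ∈ 𝒞 n, ∀ q, (∀ m < k, e p m = e q m) → q ∈ C := by
    intro p n
    obtain ⟨C, hC, hp⟩ : p ∈ ⋃₀ 𝒞 n := (h𝒞 n).2 ▸ Set.mem_univ p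
    obtain ⟨k, hk⟩ := exists_forall_lt_imp_mem he ((h𝒞 n).1 C hC) hp
    exact ⟨k, C, hC, hk⟩
  obtain ⟨b, hb⟩ := H (fun p n => Nat.find (hex p n)) fun p q n hpq => by
    refine Nat.find_min' _ ?_
    obtain ⟨C, hC, hk⟩ := Nat.find_spec (hex p n)
    exact ⟨C, hC, fun q' hq' => hk q' fun m hm => (hpq m hm).trans (hq' m hm)⟩
  let P : ∀ n, (Fin (b n) → Bool) → Prop := fun n s =>
    ∃ C ∈ 𝒞 n, ∀ q, (∀ m : Fin (b n), s m = e q m) → q ∈ C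
  let F : ∀ n, (Fin (b n) → Bool) → Set X := fun n s => if h : P n s then h.choose else ∅
  have hF : ∀ n s, P n s → F n s ∈ 𝒞 n ∧ ∀ q, (∀ m : Fin (b n), s m = e q m) → q ∈ F n s := by
    intro n s h
    have : F n s = h.choose := dif_pos h
    rw [this]
    exact h.choose_spec
  refine ⟨fun n => F n '' {s | P n s}, fun n => ⟨?_, Set.toFinite _⟩, fun S hS => ?_⟩
  · rintro _ ⟨s, hs, rfl⟩
    exact (hF n s hs).1
  · obtain ⟨n, hn⟩ := hb S hS
    refine ⟨n, fun p hp => ?_⟩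
    obtain ⟨C, hC, hk⟩ := Nat.find_spec (hex p n)
    have hPs : P n fun m => e p m :=
      ⟨C, hC, fun q hq => hk q fun m hm => hq ⟨m, hm.trans_le (hn p hp)⟩⟩
    exact ⟨_, ⟨_, hPs, rfl⟩, (hF n _ hPs).2 p fun m => rfl⟩

theorem isScheepers_of_mk_lt {X : Type} [TopologicalSpace X] {e : X → ℕ → Bool}
    (he : IsInducing e) (hX : #X < dominatingNumber) : IsScheepers X := by
  refine isScheepers_of_isInducing he fun y _ => ?_
  obtain ⟨b, -, hb⟩ := exists_strictMono_infinite_le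
    (fun (S : Finset X) n => S.sup fun p => y p n) (mk_finset_lt_dominatingNumber hX)
  refine ⟨b, fun S hS => ?_⟩
  obtain ⟨n, hn⟩ := (hb hS.toFinset).nonempty
  exact ⟨n, fun p hp => (Finset.le_sup (f := fun p => y p n) (hS.mem_toFinset.2 hp)).trans hn⟩

/-- The points meeting `[n, k)` form an open set increasing with `k`, so a finite selection from the
`n`-th cover amounts to one bound `b n`. -/
theorem not_isUMenger_of_continuous {X : Type*} [TopologicalSpace X] {U : Ultrafilter ℕ}
    {e : X → ℕ → Bool} (he : Continuous e) (hinf : ∀ p, {m | e p m = true}.Infinite)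
    (hb : ∀ b : ℕ → ℕ, ∃ p, gapSet {m | e p m = true} b ∈ U) : ¬ IsUMenger U X := by
  intro hM
  let C : ℕ → ℕ → Set X := fun n k => {p | ∃ m, n ≤ m ∧ m < k ∧ e p m = true}
  obtain ⟨ℱ, hℱ, hU⟩ := hM (fun n => Set.range (C n)) fun n => by
    refine ⟨?_, Set.eq_univ_of_forall fun p => ?_⟩
    · rintro _ ⟨k, rfl⟩
      have : C n k = ⋃ m ∈ Set.Ico n k, {p | e p m = true} := by
        ext p
        simp [C, and_assoc]
      rw [this]
      exact isOpen_biUnion fun m _ =>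
        (isOpen_discrete {true}).preimage ((continuous_apply m).comp he)
    · obtain ⟨m, hm, hnm⟩ := (hinf p).exists_gt n
      exact ⟨C n (m + 1), ⟨_, rfl⟩, m, hnm.le, Nat.lt_succ_self m, hm⟩
  have hbd : ∀ n, ∃ b, ⋃₀ ℱ n ⊆ C n b := by
    intro n
    obtain ⟨s, -, hs, hsF⟩ := (Set.exists_subset_image_finite_and (f := C n) (s := Set.univ)
      (p := fun t => t = ℱ n)).1 ⟨ℱ n, by simpa using (hℱ n).1, (hℱ n).2, rfl⟩
    refine ⟨hs.toFinset.sup id, ?_⟩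
    rw [← hsF]
    rintro p ⟨_, ⟨k, hk, rfl⟩, m, hnm, hmk, hpm⟩
    exact ⟨m, hnm, hmk.trans_le (Finset.le_sup (f := id) (hs.mem_toFinset.2 hk)), hpm⟩
  choose b hb' using hbd
  obtain ⟨p, hp⟩ := hb b
  obtain ⟨n, hn1, hn2⟩ := U.nonempty_of_mem (inter_mem hp (hU p))
  obtain ⟨m, hnm, hmb, hpm⟩ := hb' n hn2
  exact hn1 m hnm hmb hpm

theorem exists_real_isInducing (X₀ : Set (ℕ → Bool)) :
    ∃ (X : Set ℝ) (e : X → ℕ → Bool), IsInducing e ∧ Function.Injective e ∧ Set.range e = X₀ := by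
  have hφ : IsEmbedding fun p => (cantorSetHomeomorphNatToBool.symm p : ℝ) :=
    IsEmbedding.subtypeVal.comp cantorSetHomeomorphNatToBool.symm.isEmbedding
  let h := hφ.homeomorphImage X₀
  refine ⟨_, fun p => (h.symm p).1, (IsEmbedding.subtypeVal.comp h.symm.isEmbedding).isInducing,
    (IsEmbedding.subtypeVal.comp h.symm.isEmbedding).injective, ?_⟩
  change Set.range (Subtype.val ∘ h.symm) = X₀
  rw [h.symm.surjective.range_comp, Subtype.range_coe]

/-! ### The two cases -/

theorem exists_infinite_gapSet_mem (U : Ultrafilter ℕ) (f : ℕ → ℕ) :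
    ∃ y : Set ℕ, y.Infinite ∧ gapSet y f ∈ U := by
  -- The witness marks the places where `g` changes between `m` and `m + 1`; the extra 1 keeps `m +
  -- 1` inside the interval on which `g` is constant.
  obtain ⟨g, B, hg, hB, -, hgB⟩ := exists_grouping (fun _ : Unit => Set.univ)
    (fun _ => Set.infinite_univ) (fun _ _ => ⟨(), by simp⟩) U fun n => f n + 1
  refine ⟨{m | g (m + 1) ≠ g m}, fun hfin => ?_,
    mem_of_superset (Ultrafilter.compl_mem_iff_notMem.2 hB) fun n hn m hnm hm hne => hne ?_⟩
  · obtain ⟨N, hN⟩ := hfin.bddAbove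
    have hconst : ∀ k, g (N + 1 + k) = g (N + 1) := fun k => by
      induction k with
      | zero => rfl
      | succ k ih =>
        by_contra hne
        have := hN (show g (N + 1 + k + 1) ≠ g (N + 1 + k) by rw [ih]; exact hne)
        omega
    refine (Set.Ici_infinite (N + 1)).mono (fun m hm => ?_) (hg (g (N + 1)))
    obtain ⟨k, rfl⟩ := Nat.exists_eq_add_of_le (Set.mem_Ici.1 hm)
    exact hconst k
  · rw [hgB n hn m hnm (by omega), hgB n hn (m + 1) (by omega) (by omega)]

theorem exists_scheepers_of_small_unbounded {U : Ultrafilter ℕ} {J : Type} (f : J → ℕ → ℕ)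
    (hJ : #J < dominatingNumber) (hf : ∀ b : ℕ → ℕ, ∃ j, {n | f j n ≤ b n} ∉ U) :
    ∃ X : Set ℝ, IsScheepers X ∧ ¬ IsUMenger U X := by
  classical
  choose y hy hyU using fun j => exists_infinite_gapSet_mem U (f j)
  obtain ⟨X, e, he, hinj, hr⟩ := exists_real_isInducing
    (Set.range fun j m => decide (m ∈ y j))
  have hpre : ∀ p, ∃ j, {m | e p m = true} = y j := fun p => by
    obtain ⟨j, hj⟩ : e p ∈ Set.range fun j m => decide (m ∈ y j) := hr ▸ ⟨p, rfl⟩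
    exact ⟨j, by simp [← hj]⟩
  refine ⟨X, isScheepers_of_mk_lt he ?_, not_isUMenger_of_continuous he.continuous
    (fun p => ?_) fun b => ?_⟩
  · rw [← mk_range_eq e hinj, hr]
    exact mk_range_le.trans_lt hJ
  · obtain ⟨j, hj⟩ := hpre p
    rw [hj]
    exact hy j
  · obtain ⟨j, hj⟩ := hf b
    obtain ⟨p, hp⟩ : (fun m => decide (m ∈ y j)) ∈ Set.range e := hr ▸ ⟨j, rfl⟩
    refine ⟨p, ?_⟩
    have : {m | e p m = true} = y j := by simp [hp]
    rw [this]
    filter_upwards [hyU j, Ultrafilter.compl_mem_iff_notMem.2 hj] with n hn hnb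
    exact gapSet_anti (le_of_lt (not_le.1 hnb)) hn

/-- If small families of functions are bounded modulo `U`, then small sets of indices of a
dominating family indexed by a well-order of minimal type are bounded. -/
theorem exists_forall_le_of_mk_lt {U : Ultrafilter ℕ} (hU : ∀ u ∈ U, u.Infinite)
    (hbd : ∀ (J : Type) (f : J → ℕ → ℕ), #J < dominatingNumber →
      ∃ b : ℕ → ℕ, ∀ j, {n | f j n ≤ b n} ∈ U)
    {I : Type} [LinearOrder I] (hI : ∀ i : I, #(Set.Iic i) < dominatingNumber)
    (d : I → ℕ → ℕ) (hd : ∀ f : ℕ → ℕ, ∃ i, {n | d i n < f n}.Finite)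
    {J : Type} (s : J → I) (hJ : #J < dominatingNumber) : ∃ i, ∀ j, s j ≤ i := by
  by_contra! hcon
  -- If `s` were cofinal, bounds `c j` of the initial segments, bounded in turn by `b`, would make
  -- `b` bound every `d i` modulo `U`.
  choose c hc using fun j => hbd (Set.Iic (s j)) (fun i => d i) (hI _)
  obtain ⟨b, hb⟩ := hbd J c hJ
  obtain ⟨i, hi⟩ := hd fun n => b n + 1
  obtain ⟨j, hj⟩ := hcon i
  refine hU _ (inter_mem (hc j ⟨i, hj.le⟩) (hb j)) (hi.subset fun n hn => ?_)
  exact Nat.lt_succ_of_le (hn.1.trans hn.2)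

/-- A family of sets with the gap property, together with the finite sets, is Scheepers. -/
theorem isScheepers_of_gapSet_family {I : Type} [LinearOrder I] (d : I → ℕ → ℕ)
    (hd : ∀ f : ℕ → ℕ, ∃ i, {n | d i n < f n}.Finite)
    (hreg : ∀ (J : Type) (s : J → I), #J < dominatingNumber → ∃ i, ∀ j, s j ≤ i)
    (hI : ∀ i : I, #(Set.Iic i) < dominatingNumber) (x : I → Set ℕ) (hx : ∀ i, (x i).Infinite)
    (hT : ∀ T : Finset (I × I), (∀ p ∈ T, p.2 ≤ p.1) →
      (⋂ p ∈ T, gapSet (x p.1) (d p.2)).Infinite)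
    {X : Type*} [TopologicalSpace X] {e : X → ℕ → Bool} (he : IsInducing e)
    (hmem : ∀ p, {m | e p m = true}.Finite ∨ ∃ i, {m | e p m = true} = x i)
    (hfin : ∀ s : Set ℕ, s.Finite → ∃ p, {m | e p m = true} = s) : IsScheepers X := by
  classical
  refine isScheepers_of_isInducing he fun y hy => ?_
  choose q hq using fun s : Finset ℕ => hfin s s.finite_toSet
  have heq : ∀ {p p' : X} {m : ℕ}, (m ∈ {m | e p m = true} ↔ m ∈ {m | e p' m = true}) →
      e p m = e p' m := fun h => Bool.eq_iff_iff.2 h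
  let b : ℕ → ℕ := fun n => (Finset.range n).powerset.sup fun s => y (q s) n
  -- A point missing `[n, b n)` agrees below `b n` with the finite set of its elements less than
  -- `n`, so the locality of `y` applies.
  have hb : ∀ p n, n ∈ gapSet {m | e p m = true} b → y p n ≤ b n := by
    intro p n hn
    let s : Finset ℕ := (Finset.range n).filter fun m => e p m = true
    have hs : y (q s) n ≤ b n := Finset.le_sup (f := fun s => y (q s) n)
      (Finset.mem_powerset.2 (Finset.filter_subset _ _))
    refine (hy (q s) p n fun m hm => heq ?_).trans hs
    rw [hq s]
    by_cases hmn : m < n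
    · simp [s, hmn]
    · have := hn m (not_lt.1 hmn) (hm.trans_le hs)
      simp only [Set.mem_ofPred_eq] at this
      simp [s, hmn, this]
  obtain ⟨β, hβ⟩ := hd b
  have hex : ∀ i, ∃ γ, ∀ p, {m | e p m = true} = x i → {n | d γ n < y p n}.Finite := by
    intro i
    by_cases hp : ∃ p, {m | e p m = true} = x i
    · obtain ⟨p, hp⟩ := hp
      obtain ⟨γ, hγ⟩ := hd (y p)
      refine ⟨γ, fun p' hp' => ?_⟩
      have hee : ∀ m, e p m = e p' m := fun m => heq (by rw [hp, hp'])
      have : y p' = y p := funext fun n => le_antisymm (hy p p' n fun m _ => hee m)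
        (hy p' p n fun m _ => (hee m).symm)
      rwa [this]
    · exact ⟨i, fun p h => absurd ⟨p, h⟩ hp⟩
  choose γ hγ using hex
  -- For `i ≤ β` the gaps of `x δ` replace those of `x i`: if `x δ` misses `[n, d (γ i) n)`, then
  -- its element `φ n > n` is at least `d (γ i) n`, which bounds `y` at `x i` for almost all `n`.
  obtain ⟨δ, hδ⟩ := hreg (Set.Iic β) (fun i => γ i) (hI β)
  choose φ hφx hφ using fun n => (hx δ).exists_gt n
  refine ⟨fun n => max (b n) (φ n), fun S hS => ?_⟩
  -- Each point of `S` imposes finitely many exceptions, besides membership in one gap set.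
  have hpt : ∀ p : X, ∃ t : I × I, t.2 ≤ t.1 ∧
      {n | n ∈ gapSet (x t.1) (d t.2) ∧ ¬ y p n ≤ max (b n) (φ n)}.Finite := by
    intro p
    rcases hmem p with hp | ⟨i, hi⟩
    · refine ⟨(β, β), le_rfl, ?_⟩
      obtain ⟨N, hN⟩ := hp.bddAbove
      refine (Set.finite_Iic N).subset fun n hn => ?_
      by_contra hnN
      exact hn.2 ((hb p n fun m hnm _ hm => hnN (hnm.trans (hN hm))).trans (le_max_left _ _))
    · rcases le_total β i with h | h
      · refine ⟨(i, β), h, hβ.subset fun n hn => ?_⟩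
        by_contra hlt
        exact hn.2 ((hb p n (hi ▸ gapSet_anti (not_lt.1 hlt) hn.1)).trans (le_max_left _ _))
      · refine ⟨(δ, γ i), hδ ⟨i, h⟩, (hγ i p hi).subset fun n hn => ?_⟩
        by_contra hlt
        have : d (γ i) n ≤ φ n := by
          by_contra hlt'
          exact hn.1 _ (hφ n).le (not_le.1 hlt') (hφx n)
        exact hn.2 (((not_lt.1 hlt).trans this).trans (le_max_right _ _))
  choose t ht hfin' using hpt
  have hinf := hT (hS.toFinset.image t) fun r hr => by
    obtain ⟨p, -, rfl⟩ := Finset.mem_image.1 hr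
    exact ht p
  obtain ⟨n, hn, hn'⟩ := (hinf.sdiff (hS.biUnion fun p _ => hfin' p)).nonempty
  refine ⟨n, fun p hp => ?_⟩
  by_contra hlt
  refine hn' (Set.mem_biUnion hp ⟨?_, hlt⟩)
  exact Set.mem_iInter₂.1 hn _ (Finset.mem_image_of_mem t (hS.mem_toFinset.2 hp))

theorem exists_scheepers_of_small_bounded (hdr : dominatingNumber ≤ reapingNumber)
    {U : Ultrafilter ℕ} (hU : ∀ u ∈ U, u.Infinite)
    (hbd : ∀ (J : Type) (f : J → ℕ → ℕ), #J < dominatingNumber →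
      ∃ b : ℕ → ℕ, ∀ j, {n | f j n ≤ b n} ∈ U) :
    ∃ X : Set ℝ, IsScheepers X ∧ ¬ IsUMenger U X := by
  classical
  obtain ⟨I, D, hD, hDc⟩ : ∃ (I : Type) (D : I → InfNatSet),
      (∀ a : InfNatSet, ∃ i, a.DominatedBy (D i)) ∧ #I = dominatingNumber := by
    obtain ⟨D, hD, hDc⟩ := exists_isDominatingFamily
    refine ⟨D, Subtype.val, fun a => ?_, hDc⟩
    obtain ⟨i, hi, hai⟩ := hD a
    exact ⟨⟨i, hi⟩, hai⟩
  obtain ⟨_, _, hord⟩ := exists_ord_eq_type_lt I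
  have hI : ∀ i : I, #(Set.Iic i) < dominatingNumber := fun i =>
    hDc ▸ mk_Iic_lt i hord (hDc ▸ aleph0_lt_dominatingNumber.le)
  let d : I → ℕ → ℕ := fun i => (D i).enum
  have hd : ∀ f : ℕ → ℕ, ∃ i, {n | d i n < f n}.Finite := fun f => by
    obtain ⟨a, ha⟩ := InfNatSet.exists_le_enum f
    obtain ⟨i, hai⟩ := hD a
    exact ⟨i, Set.Finite.subset hai fun n hn => lt_of_lt_of_le hn (ha n)⟩
  obtain ⟨x, hx, hT⟩ := exists_gapSet_family hdr hU hI d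
  obtain ⟨X, e, he, -, hr⟩ := exists_real_isInducing
    {p | {m | p m = true}.Finite ∨ ∃ i, {m | p m = true} = x i}
  have hmem : ∀ p, {m | e p m = true}.Finite ∨ ∃ i, {m | e p m = true} = x i := fun p =>
    hr.subset ⟨p, rfl⟩
  have hex : ∀ s : Set ℕ, (s.Finite ∨ ∃ i, s = x i) → ∃ p, {m | e p m = true} = s := by
    intro s hs
    obtain ⟨p, hp⟩ := hr.superset (show (fun m => decide (m ∈ s)) ∈ _ by simpa using hs)
    exact ⟨p, by simp [hp]⟩
  have hcompl : ∀ p, {m | (!e p m) = true} = {m | e p m = true}ᶜ := fun p => by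
    ext m
    simp
  refine ⟨X, isScheepers_of_gapSet_family d hd
    (fun J s hJ => exists_forall_le_of_mk_lt hU hbd hI d hd s hJ) hI x (fun i => (hx i).1) hT he
    hmem fun s hs => hex s (.inl hs), not_isUMenger_of_continuous (e := fun p m => !e p m)
    ?_ (fun p => ?_) fun b => ?_⟩
  · exact continuous_pi fun m => (continuous_of_discreteTopology (f := Bool.not)).comp
      ((continuous_apply m).comp he.continuous)
  · rw [hcompl]
    rcases hmem p with h | ⟨i, hi⟩
    · exact h.infinite_compl
    · rw [hi]
      exact (hx i).2.1
  · obtain ⟨i, hi⟩ := hd b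
    obtain ⟨p, hp⟩ := hex (x i) (.inr ⟨i, rfl⟩)
    refine ⟨p, ?_⟩
    rw [hcompl, hp]
    have hic : {n | d i n < b n}ᶜ ∈ U :=
      Ultrafilter.compl_mem_iff_notMem.2 fun h => hU _ h hi
    filter_upwards [(hx i).2.2, hic] with n hn hnb
    exact gapSet_anti (not_lt.1 hnb) hn

theorem corollary2p11 (hdr : dominatingNumber ≤ reapingNumber)
    (U : Ultrafilter ℕ) (hU : ∀ u ∈ U, u.Infinite) :
    ∃ X : Set ℝ, IsScheepers X ∧ ¬ IsUMenger U X := by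
  by_cases h : ∃ (J : Type) (f : J → ℕ → ℕ), #J < dominatingNumber ∧
      ∀ b : ℕ → ℕ, ∃ j, {n | f j n ≤ b n} ∉ U
  · obtain ⟨J, f, hJ, hf⟩ := h
    exact exists_scheepers_of_small_unbounded f hJ hf
  · push Not at h
    exact exists_scheepers_of_small_bounded hdr hU h
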